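/- **Theorem (Luckiness with location and scale parameters).** Let $m\ge 1$ and $n\ge 0$ be integers, $\nu>m-1$, $\rho^2>0$, $\mu_0\in\mathbb{R}^m$, and let $\Sigma_0\in\mathbb{R}^{m\times m}$ be (symmetric) positive definite. For $x^n=(x_1,\dots,x_n)\in(\mathbb{R}^m)^n$, $\mu\in\mathbb{R}^m$ and positive definite $\Sigma\in\mathbb{R}^{m\times m}$, write $|\cdot|$ for the determinant and put $$f(x^n;\mu,\Sigma)=\frac{1}{(2\pi)^{\frac{mn}{2}}|\Sigma|^{\frac n2}}\exp\Big\{-\frac12\sum_{i=1}^n (x_i-\mu)^\top\Sigma^{-1}(x_i-\mu)\Big\},$$ $$\pi(\mu,\Sigma;\nu,\mu_0,\Sigma_0,\rho^2)=\frac{1}{(2\pi)^{\frac{m\nu}{2}}|\Sigma|^{\frac \nu2}}\exp\Big[-\frac\nu2\operatorname{tr}\big\{\Sigma^{-1}\big(\Sigma_0+\rho^2(\mu-\mu_0)(\mu-\mu_0)^\top\big)\big\}\Big].$$ Let $\mathcal{M}^n=\{f(\cdot;\mu,\Sigma)\,\pi(\mu,\Sigma;\nu,\mu_0,\Sigma_0,\rho^2)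 : \mu\in\mathbb{R}^m,\ \Sigma>0\}$ be the model of $n$ independent $m$-dimensional normal observations with luckiness $\pi$. Its capacity is $C(\mathcal{M}^n)=\int \max_{p\in\mathcal{M}^n}p(x^n)\,dx^n$ (Lebesgue measure), and the LNML (normalized maximum likelihood with luckiness) is $\bar p_n(x^n)=\max_{p\in\mathcal{M}^n}p(x^n)/C(\mathcal{M}^n)$. Further let $\Gamma_m(z)=\pi^{\frac{m(m-1)}4}\prod_{j=0}^{m-1}\Gamma(z-\frac j2)$ and, for $\sigma>0$, $$\mathcal{C}(m,n,\nu,\sigma^2,\rho^2)=\frac{1}{\sigma^{m\nu}}\left(\frac{(n+\nu)^{n+\nu}\big(1+\frac{n}{\rho^2\nu}\big)}{(2e)^{n+\nu}(\pi\nu)^\nu}\right)^{\frac m2}\frac{\Gamma_m(\frac\nu2)}{\Gamma_m(\frac{n+\nu}2)}.$$ Then for every $x^n$ the function $(\mu,\Sigma)\mapsto f(x^n;\mu,\Sigma)\,\pi(\mu,\Sigma;\nu,\mu_0,\Sigma_0,\rho^2)$ attains its maximum over $\mu\in\mathbb{R}^m$, $\Sigma>0$ at exactly one point, the maximum a-posteriori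 (MAP) estimate $(\bar\mu_n,\bar\Sigma_n)$ under the prior proportional to $\pi$, given by $$\bar\mu_n=\mu_0+\frac{1}{n+\rho^2\nu}\sum_{i=1}^n(x_i-\mu_0),$$ $$\bar\Sigma_n=\frac{1}{n+\nu}\Big(\sum_{i=1}^n(x_i-\mu_0)(x_i-\mu_0)^\top+\nu\Sigma_0\Big)-\frac{1}{(\nu+n)(\rho^2\nu+n)}\sum_{i,j=1}^n(x_i-\mu_0)(x_j-\mu_0)^\top.$$ The capacity is finite and equals $$C(\mathcal{M}^n)=\mathcal{C}(m,n,\nu,|\Sigma_0|^{1/m},\rho^2),$$ and for every $x^n$ the LNML is $$\bar p_n(x^n)=\frac{f(x^n;\bar\mu_n,\bar\Sigma_n)\,\pi(\bar\mu_n,\bar\Sigma_n;\nu,\mu_0,\Sigma_0,\rho^2)}{\mathcal{C}(m,n,\nu,|\Sigma_0|^{1/m},\rho^2)} =\left(\frac{\nu^\nu}{\pi^n(n+\nu)^{n+\nu}\big(1+\frac{n}{\rho^2\nu}\big)}\right)^{\frac m2}\frac{\Gamma_m(\frac{n+\nu}2)}{\Gamma_m(\frac\nu2)}\,\frac{|\Sigma_0|^{\frac\nu2}}{|\bar\Sigma_n|^{\frac{n+\nu}2}}.$$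 -/

import Mathlib

open MeasureTheory Matrix
open scoped BigOperators

noncomputable section

namespace LNML

/-! ### Unnormalized models, capacity and LNML -/

/-- The maximum `max_{p ∈ M} p x` over an unnormalized model `M`, a set of nonnegative functions
(densities multiplied by their luckiness). It is the maximum whenever that exists. -/
def maxValue {X : Type*} (M : Set (X → ℝ)) (x : X) : ℝ :=
  sSup {v : ℝ | ∃ p ∈ M, p x = v}

/-- The capacity `C(M) = ∫ max_{p ∈ M} p x dμ(x)`. -/
def capacity {X : Type*} [MeasurableSpace X] (μ : Measure X) (M : Set (X → ℝ)) : ℝ :=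
  ∫ x, maxValue M x ∂μ

/-- The normalized maximum likelihood density (with luckiness)
`x ↦ max_{p ∈ M} p x / C(M)` of an unnormalized model `M`. -/
def lnml {X : Type*} [MeasurableSpace X] (μ : Measure X) (M : Set (X → ℝ)) (x : X) : ℝ :=
  maxValue M x / capacity μ M

/-! ### The multivariate normal model -/

/-- The joint density `f(xⁿ; μ, S)` of `n` independent observations from the `m`-dimensional normal
distribution with mean `μ` and covariance matrix `S`. -/
def normalDensity {m n : ℕ} (x : Fin n → Fin m → ℝ) (μ : Fin m → ℝ)
    (S : Matrix (Fin m) (Fin m) ℝ) : ℝ :=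
  1 / ((2 * Real.pi) ^ ((m : ℝ) * n / 2) * S.det ^ ((n : ℝ) / 2)) *
    Real.exp (-(1 / 2) * ∑ i, (x i - μ) ⬝ᵥ (S⁻¹ *ᵥ (x i - μ)))

/-- The luckiness `π(μ, S; ν, μ₀, S₀, ρ²)` with location `μ₀` and scale matrix `S₀`;
the argument `ρsq` is `ρ²`. -/
def luckiness {m : ℕ} (ν : ℝ) (μ₀ : Fin m → ℝ) (S₀ : Matrix (Fin m) (Fin m) ℝ) (ρsq : ℝ)
    (μ : Fin m → ℝ) (S : Matrix (Fin m) (Fin m) ℝ) : ℝ :=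
  1 / ((2 * Real.pi) ^ ((m : ℝ) * ν / 2) * S.det ^ (ν / 2)) *
    Real.exp (-(ν / 2) * (S⁻¹ * (S₀ + ρsq • vecMulVec (μ - μ₀) (μ - μ₀))).trace)

/-- The unnormalized model `{f(·; μ, S) π(μ, S; ν, μ₀, S₀, ρ²) : μ ∈ ℝᵐ, S > 0}` of `n`
observations. -/
def normalModel {m : ℕ} (n : ℕ) (ν : ℝ) (μ₀ : Fin m → ℝ) (S₀ : Matrix (Fin m) (Fin m) ℝ)
    (ρsq : ℝ) : Set ((Fin n → Fin m → ℝ) → ℝ) :=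
  {p | ∃ (μ : Fin m → ℝ) (S : Matrix (Fin m) (Fin m) ℝ), S.PosDef ∧
    p = fun x => normalDensity x μ S * luckiness ν μ₀ S₀ ρsq μ S}

/-- `(μ, S)` is a maximum a-posteriori estimate for the data `x` under the prior proportional to
the luckiness: `S` is positive definite and `(μ, S)` maximizes likelihood times luckiness over all
means and all positive definite covariance matrices. -/
def IsMAP {m n : ℕ} (ν : ℝ) (μ₀ : Fin m → ℝ) (S₀ : Matrix (Fin m) (Fin m) ℝ) (ρsq : ℝ)
    (x : Fin n → Fin m → ℝ) (μ : Fin m → ℝ) (S : Matrix (Fin m) (Fin m) ℝ) : Prop :=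
  S.PosDef ∧ ∀ (μ' : Fin m → ℝ) (S' : Matrix (Fin m) (Fin m) ℝ), S'.PosDef →
    normalDensity x μ' S' * luckiness ν μ₀ S₀ ρsq μ' S' ≤
      normalDensity x μ S * luckiness ν μ₀ S₀ ρsq μ S

/-- The estimate `μ̄ₙ = μ₀ + (n + ρ²ν)⁻¹ ∑ᵢ (xᵢ - μ₀)`. -/
def mapMean {m n : ℕ} (ν : ℝ) (μ₀ : Fin m → ℝ) (ρsq : ℝ) (x : Fin n → Fin m → ℝ) :
    Fin m → ℝ :=
  μ₀ + (1 / ((n : ℝ) + ρsq * ν)) • ∑ i, (x i - μ₀)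

/-- The estimate `S̄ₙ = (n + ν)⁻¹ (∑ᵢ (xᵢ - μ₀)(xᵢ - μ₀)ᵀ + ν S₀)
- ((ν + n)(ρ²ν + n))⁻¹ ∑ᵢⱼ (xᵢ - μ₀)(xⱼ - μ₀)ᵀ`. -/
def mapCov {m n : ℕ} (ν : ℝ) (μ₀ : Fin m → ℝ) (S₀ : Matrix (Fin m) (Fin m) ℝ) (ρsq : ℝ)
    (x : Fin n → Fin m → ℝ) : Matrix (Fin m) (Fin m) ℝ :=
  (1 / ((n : ℝ) + ν)) • (∑ i, vecMulVec (x i - μ₀) (x i - μ₀) + ν • S₀) -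
    (1 / ((ν + n) * (ρsq * ν + n))) • ∑ i, ∑ j, vecMulVec (x i - μ₀) (x j - μ₀)

/-! ### The constants -/

/-- The multivariate gamma function `Γ_m(z) = π^{m(m-1)/4} ∏_{j<m} Γ(z - j/2)`. -/
def multiGamma (m : ℕ) (z : ℝ) : ℝ :=
  Real.pi ^ ((m : ℝ) * ((m : ℝ) - 1) / 4) * ∏ j ∈ Finset.range m, Real.Gamma (z - (j : ℝ) / 2)

/-- The constant `𝒞(m, n, ν, σ², ρ²)`; the arguments `σsq` and `ρsq` are `σ²` and `ρ²`. -/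
def capacityConst (m n : ℕ) (ν σsq ρsq : ℝ) : ℝ :=
  1 / (√σsq) ^ ((m : ℝ) * ν) *
    (((n : ℝ) + ν) ^ ((n : ℝ) + ν) * (1 + (n : ℝ) / (ρsq * ν)) /
      ((2 * Real.exp 1) ^ ((n : ℝ) + ν) * (Real.pi * ν) ^ ν)) ^ ((m : ℝ) / 2) *
    (multiGamma m (ν / 2) / multiGamma m (((n : ℝ) + ν) / 2))

end LNML

end

/-! The luckiness acts like extra observations. With c = ρ²ν, completing the square
(`sum_vecMulVec_sub_add`) splits the total scatter into a part free of μ and a rank-one term that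
vanishes only at the MAP mean. Hence (`normalDensity_mul_luckiness`) the objective is a constant
times det S ^ (-a) · exp(-a tr(S⁻¹T)), where a = (n+ν)/2 and T is the MAP covariance, times a
Gaussian factor in μ that is at most 1. Congruence and diagonalization reduce the maximization over
S to t·e⁻ᵗ ≤ e⁻¹ on eigenvalues, with equality only at t = 1, so S = T is the unique maximizer.

The maximum is therefore a constant times det(νS₀ + scatter) ^ (-a), and the capacity is its
integral. By Welford's recursion (`scatter_cons`) each observation is a rank-one update, and
integrating one out is an m-dimensional Cauchy-type integral (`lintegral_one_add_dotProduct_rpow`)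
that lowers the exponent by 1/2. After n rounds (`lintegral_det_add_scatter`) the Gamma quotients
telescope to a quotient of `multiGamma`, and the update weights to (n+c)/c = 1 + n/(ρ²ν). -/

noncomputable section

namespace LNML

variable {m n : ℕ}

/-! ### Positive definite matrices and the determinant–trace inequality. -/

section LinearAlgebra

open scoped MatrixOrder ComplexOrder in
lemma exists_eq_mul_transpose {B : Matrix (Fin m) (Fin m) ℝ} (hB : B.PosDef) :
    ∃ L : Matrix (Fin m) (Fin m) ℝ, L.det ≠ 0 ∧ B = L * Lᵀ := by
  obtain ⟨M, hM⟩ := CStarAlgebra.nonneg_iff_eq_star_mul_self.mp hB.posSemidef.nonneg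
  rw [star_eq_conjTranspose, conjTranspose_eq_transpose_of_trivial] at hM
  refine ⟨Mᵀ, fun h => ?_, by simpa using hM⟩
  have := hB.det_pos
  rw [hM, det_mul, h, zero_mul] at this
  exact this.false

lemma dotProduct_mulVec_eq_trace (M : Matrix (Fin m) (Fin m) ℝ) (u : Fin m → ℝ) :
    u ⬝ᵥ (M *ᵥ u) = (M * vecMulVec u u).trace := by
  rw [mul_vecMulVec, trace_vecMulVec, dotProduct_comm]

lemma posSemidef_vecMulVec (u : Fin m → ℝ) : (vecMulVec u u).PosSemidef := by
  simpa using posSemidef_vecMulVec_self_star u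

lemma det_one_add_vecMulVec_self (u : Fin m → ℝ) : (1 + vecMulVec u u).det = 1 + u ⬝ᵥ u := by
  rw [vecMulVec_eq Unit, det_one_add_replicateCol_mul_replicateRow]

/-- For positive definite `K` the product `det K * exp (-tr K)` is at most `exp (-m)`. -/
lemma det_mul_exp_neg_trace_le {K : Matrix (Fin m) (Fin m) ℝ} (hK : K.PosDef) :
    K.det * Real.exp (-K.trace) ≤ Real.exp (-m) ∧
      (K.det * Real.exp (-K.trace) = Real.exp (-m) → K = 1) := by
  have hpos := hK.eigenvalues_pos
  set ev := hK.1.eigenvalues with hev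
  have hdet : K.det = ∏ i, ev i := by simpa using hK.1.det_eq_prod_eigenvalues
  have htr : K.trace = ∑ i, ev i := by simpa using hK.1.trace_eq_sum_eigenvalues
  have h1 : K.det * Real.exp (-K.trace) = ∏ i, (ev i * Real.exp (-ev i)) := by
    rw [hdet, htr, ← Finset.sum_neg_distrib, Real.exp_sum, Finset.prod_mul_distrib]
  have h2 : Real.exp (-(m : ℝ)) = ∏ _i : Fin m, Real.exp (-1) := by
    rw [Finset.prod_const, ← Real.exp_nat_mul]; simp
  -- The scalar case comes from t ≤ exp (t - 1), which is strict for t ≠ 1; strictness at one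
  -- eigenvalue then makes the whole product strict.
  have hle : ∀ t : ℝ, t * Real.exp (-t) ≤ Real.exp (-1) := fun t => by
    have := Real.add_one_le_exp (t - 1)
    calc t * Real.exp (-t) ≤ Real.exp (t - 1) * Real.exp (-t) := by gcongr; linarith
      _ = Real.exp (-1) := by rw [← Real.exp_add]; ring_nf
  have hlt : ∀ t : ℝ, t ≠ 1 → t * Real.exp (-t) < Real.exp (-1) := fun t ht => by
    have := Real.add_one_lt_exp (sub_ne_zero.2 ht)
    calc t * Real.exp (-t) < Real.exp (t - 1) * Real.exp (-t) := by gcongr; linarith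
      _ = Real.exp (-1) := by rw [← Real.exp_add]; ring_nf
  rw [h1, h2]
  refine ⟨Finset.prod_le_prod (fun i _ => mul_nonneg (hpos i).le (Real.exp_pos _).le)
    fun i _ => hle _, fun h => ?_⟩
  have hone : ∀ i, ev i = 1 := by
    by_contra! hne
    obtain ⟨i, hi⟩ := hne
    refine (Finset.prod_lt_prod (fun i _ => mul_pos (hpos i) (Real.exp_pos _))
      (fun i _ => hle _) ⟨i, Finset.mem_univ i, hlt _ hi⟩).ne h
  rw [hK.1.spectral_theorem]
  have : hK.1.eigenvalues = fun _ => 1 := funext hone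
  simp [this]

lemma det_inv_eq {S T L : Matrix (Fin m) (Fin m) ℝ} (hT : T = L * Lᵀ) :
    (Lᵀ * S⁻¹ * L).det = T.det / S.det := by
  rw [hT, det_mul, det_mul, det_mul, det_nonsing_inv, Ring.inverse_eq_inv']
  ring

/-- Gaussian profile maximization over the covariance matrix. -/
lemma det_rpow_mul_exp_trace_le {S T : Matrix (Fin m) (Fin m) ℝ} (hS : S.PosDef)
    (hT : T.PosDef) {a : ℝ} (ha : 0 < a) :
    S.det ^ (-a) * Real.exp (-a * (S⁻¹ * T).trace) ≤ T.det ^ (-a) * Real.exp (-a * m) ∧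
      (S.det ^ (-a) * Real.exp (-a * (S⁻¹ * T).trace) = T.det ^ (-a) * Real.exp (-a * m) →
        S = T) := by
  obtain ⟨L, hL, hTL⟩ := exists_eq_mul_transpose hT
  have hLu : IsUnit L := (isUnit_iff_isUnit_det L).2 hL.isUnit
  -- S⁻¹T need not be symmetric; the congruent matrix K is positive definite with the same trace and
  -- determinant.
  set K := Lᵀ * S⁻¹ * L with hKdef
  have hK : K.PosDef := by
    have := hS.inv.conjTranspose_mul_mul_same (B := L) (mulVec_injective_of_isUnit hLu)
    rwa [conjTranspose_eq_transpose_of_trivial] at this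
  have htr : (S⁻¹ * T).trace = K.trace := by
    rw [hTL, hKdef, ← Matrix.mul_assoc, trace_mul_comm, Matrix.mul_assoc]
  have hdet : S.det = T.det / K.det := by
    rw [hKdef, det_inv_eq hTL]
    have := hS.det_pos.ne'
    have := hT.det_pos.ne'
    field_simp
  have key : S.det ^ (-a) * Real.exp (-a * (S⁻¹ * T).trace) =
      T.det ^ (-a) * (K.det * Real.exp (-K.trace)) ^ a := by
    rw [htr, hdet, Real.div_rpow hT.det_pos.le hK.det_pos.le,
      Real.mul_rpow hK.det_pos.le (Real.exp_pos _).le, ← Real.exp_mul,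
      Real.rpow_neg hK.det_pos.le, div_inv_eq_mul]
    ring_nf
  have key2 : Real.exp (-a * m) = (Real.exp (-m)) ^ a := by
    rw [← Real.exp_mul]; ring_nf
  obtain ⟨h1, h2⟩ := det_mul_exp_neg_trace_le hK
  have hTa : 0 < T.det ^ (-a) := Real.rpow_pos_of_pos hT.det_pos _
  have hKn : 0 ≤ K.det * Real.exp (-K.trace) := mul_nonneg hK.det_pos.le (Real.exp_pos _).le
  rw [key, key2]
  refine ⟨by gcongr, fun h => ?_⟩
  have h3 := h2 (by
    have := mul_left_cancel₀ hTa.ne' h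
    exact (Real.rpow_left_inj hKn (Real.exp_pos _).le ha.ne').1 this)
  have hLdet : IsUnit L.det := hL.isUnit
  have hSdet : IsUnit S.det := hS.det_pos.ne'.isUnit
  have hLtdet : IsUnit Lᵀ.det := by rwa [det_transpose]
  -- Equality forces K = 1, and undoing the congruence gives S⁻¹ = T⁻¹.
  have h4 : S⁻¹ = (Lᵀ)⁻¹ * L⁻¹ := by
    rw [← Matrix.one_mul L⁻¹, ← h3, hKdef, Matrix.mul_nonsing_inv_cancel_right _ _ hLdet,
      Matrix.nonsing_inv_mul_cancel_left _ _ hLtdet]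
  rw [← Matrix.mul_inv_rev, ← hTL] at h4
  rw [← nonsing_inv_nonsing_inv S hSdet, h4, nonsing_inv_nonsing_inv T hT.det_pos.ne'.isUnit]

end LinearAlgebra

/-! ### Gaussian, Gamma and Cauchy-type integrals. -/

section Integrals

/-- The Bochner integral of a non-integrable function is 0, so a nonzero value certifies
integrability. Known real integrals thus move to `ENNReal`, where Tonelli needs no finiteness. -/
lemma lintegral_ofReal_of_integral_eq {X : Type*} [MeasurableSpace X] {μ : Measure X} {f : X → ℝ}
    {c : ℝ} (hf : 0 ≤ᵐ[μ] f) (hc : c ≠ 0) (h : ∫ x, f x ∂μ = c) :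
    ∫⁻ x, ENNReal.ofReal (f x) ∂μ = ENNReal.ofReal c := by
  have hi : Integrable f μ := by
    by_contra hn
    exact hc (h.symm.trans (integral_undef hn))
  rw [← h, ofReal_integral_eq_lintegral_ofReal hi hf]

lemma lintegral_gaussian_pi {t : ℝ} (ht : 0 < t) :
    ∫⁻ v : Fin m → ℝ, ENNReal.ofReal (Real.exp (-(t * (v ⬝ᵥ v)))) =
      ENNReal.ofReal ((Real.pi / t) ^ ((m : ℝ) / 2)) := by
  have hpt : 0 < Real.pi / t := div_pos Real.pi_pos ht
  refine lintegral_ofReal_of_integral_eq (Filter.Eventually.of_forall fun v => (Real.exp_pos _).le)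
    (Real.rpow_pos_of_pos hpt _).ne' ?_
  have h : ∀ v : Fin m → ℝ, Real.exp (-(t * (v ⬝ᵥ v))) = ∏ i, Real.exp (-t * v i ^ 2) := by
    intro v
    rw [← Real.exp_sum, dotProduct, Finset.mul_sum, ← Finset.sum_neg_distrib]
    congr 1
    exact Finset.sum_congr rfl fun i _ => by ring
  simp_rw [h]
  rw [integral_fintype_prod_volume_eq_pow (fun x : ℝ => Real.exp (-t * x ^ 2)), integral_gaussian,
    Fintype.card_fin, Real.sqrt_eq_rpow, ← Real.rpow_natCast, ← Real.rpow_mul hpt.le]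
  ring_nf

lemma lintegral_rpow_mul_exp {a r : ℝ} (ha : 0 < a) (hr : 0 < r) :
    ∫⁻ t in Set.Ioi (0 : ℝ), ENNReal.ofReal (t ^ (a - 1) * Real.exp (-(r * t))) =
      ENNReal.ofReal (r ^ (-a) * Real.Gamma a) := by
  refine lintegral_ofReal_of_integral_eq ?_ ?_ ?_
  · filter_upwards [self_mem_ae_restrict measurableSet_Ioi] with t ht
    exact mul_nonneg (Real.rpow_nonneg (le_of_lt ht) _) (Real.exp_pos _).le
  · exact (mul_pos (Real.rpow_pos_of_pos hr _) (Real.Gamma_pos_of_pos ha)).ne'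
  · rw [Real.integral_rpow_mul_exp_neg_mul_Ioi ha hr, one_div, Real.inv_rpow hr.le,
      Real.rpow_neg hr.le]

lemma zero_le_dotProduct_self (v : Fin m → ℝ) : 0 ≤ v ⬝ᵥ v :=
  Finset.sum_nonneg fun _ _ => mul_self_nonneg _

/-- The normalization of the multivariate Cauchy-type density. -/
lemma lintegral_one_add_dotProduct_rpow {a : ℝ} (ha : (m : ℝ) / 2 < a) :
    ∫⁻ v : Fin m → ℝ, ENNReal.ofReal ((1 + v ⬝ᵥ v) ^ (-a)) =
      ENNReal.ofReal (Real.pi ^ ((m : ℝ) / 2) * Real.Gamma (a - (m : ℝ) / 2) / Real.Gamma a) := by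
  have ha0 : 0 < a := lt_of_le_of_lt (by positivity) ha
  have hG := Real.Gamma_pos_of_pos ha0
  have hdot : Continuous fun v : Fin m → ℝ => v ⬝ᵥ v := by
    unfold dotProduct; fun_prop
  have hmeas : Measurable fun p : (Fin m → ℝ) × ℝ =>
      ENNReal.ofReal (p.2 ^ (a - 1) * Real.exp (-((1 + p.1 ⬝ᵥ p.1) * p.2))) := by
    have h1 : Measurable fun p : (Fin m → ℝ) × ℝ => p.1 ⬝ᵥ p.1 :=
      hdot.measurable.comp measurable_fst
    fun_prop
  -- Γ(a)·s⁻ᵃ is the integral of t^(a-1)·e^(-st) over t > 0. With s = 1 + v·v, Tonelli leaves a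
  -- Gaussian in v worth (π/t)^(m/2), and the remaining t-integral is Γ(a - m/2).
  have key : ENNReal.ofReal (Real.Gamma a) *
      ∫⁻ v : Fin m → ℝ, ENNReal.ofReal ((1 + v ⬝ᵥ v) ^ (-a)) =
      ENNReal.ofReal (Real.pi ^ ((m : ℝ) / 2) * Real.Gamma (a - (m : ℝ) / 2)) := by
    calc _ = ∫⁻ v : Fin m → ℝ, ∫⁻ t in Set.Ioi (0 : ℝ),
          ENNReal.ofReal (t ^ (a - 1) * Real.exp (-((1 + v ⬝ᵥ v) * t))) := by
          rw [← lintegral_const_mul' _ _ ENNReal.ofReal_ne_top]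
          refine lintegral_congr fun v => ?_
          have := zero_le_dotProduct_self v
          rw [lintegral_rpow_mul_exp ha0 (by linarith), ← ENNReal.ofReal_mul hG.le, mul_comm]
      _ = ∫⁻ t in Set.Ioi (0 : ℝ), ∫⁻ v : Fin m → ℝ,
          ENNReal.ofReal (t ^ (a - 1) * Real.exp (-((1 + v ⬝ᵥ v) * t))) :=
          lintegral_lintegral_swap hmeas.aemeasurable
      _ = ∫⁻ t in Set.Ioi (0 : ℝ), ENNReal.ofReal (Real.pi ^ ((m : ℝ) / 2)) *
          ENNReal.ofReal (t ^ (a - (m : ℝ) / 2 - 1) * Real.exp (-(1 * t))) := by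
          refine setLIntegral_congr_fun measurableSet_Ioi fun t ht => ?_
          have ht : 0 < t := ht
          have hsplit : ∀ v : Fin m → ℝ,
              ENNReal.ofReal (t ^ (a - 1) * Real.exp (-((1 + v ⬝ᵥ v) * t))) =
              ENNReal.ofReal (t ^ (a - 1) * Real.exp (-t)) *
                ENNReal.ofReal (Real.exp (-(t * (v ⬝ᵥ v)))) := fun v => by
            rw [← ENNReal.ofReal_mul (by positivity), mul_assoc, ← Real.exp_add]
            ring_nf
          simp_rw [hsplit]
          rw [lintegral_const_mul' _ _ ENNReal.ofReal_ne_top, lintegral_gaussian_pi ht,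
            ← ENNReal.ofReal_mul (by positivity),
            ← ENNReal.ofReal_mul (Real.rpow_nonneg Real.pi_pos.le _),
            Real.div_rpow Real.pi_pos.le ht.le,
            show a - (m : ℝ) / 2 - 1 = (a - 1) - (m : ℝ) / 2 by ring, Real.rpow_sub ht (a - 1), one_mul]
          congr 1
          ring
      _ = _ := by
          rw [lintegral_const_mul' _ _ ENNReal.ofReal_ne_top,
            lintegral_rpow_mul_exp (by linarith) one_pos,
            ← ENNReal.ofReal_mul (by positivity), Real.one_rpow, one_mul]
  rw [ENNReal.ofReal_div_of_pos hG, ← key, mul_comm, ENNReal.mul_div_cancel_right]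
  · simpa using hG
  · exact ENNReal.ofReal_ne_top

lemma lintegral_eq_abs_det_mul_lintegral_mulVec {L : Matrix (Fin m) (Fin m) ℝ} (hL : L.det ≠ 0)
    {F : (Fin m → ℝ) → ENNReal} (hF : Measurable F) :
    ∫⁻ y, F y = ENNReal.ofReal |L.det| * ∫⁻ v, F (L *ᵥ v) := by
  have h := Real.map_matrix_volume_pi_eq_smul_volume_pi hL
  have hm : Measurable fun v : Fin m → ℝ => L *ᵥ v :=
    (Continuous.matrix_mulVec continuous_const continuous_id).measurable
  have h2 : ∫⁻ v, F (L *ᵥ v) = ENNReal.ofReal |L.det⁻¹| * ∫⁻ y, F y := by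
    rw [← lintegral_map (f := F) hF hm, ← smul_eq_mul, ← lintegral_smul_measure, ← h]
    rfl
  rw [h2, ← mul_assoc, ← ENNReal.ofReal_mul (abs_nonneg _), ← abs_mul, mul_inv_cancel₀ hL]
  simp

lemma posDef_add_smul_vecMulVec {B : Matrix (Fin m) (Fin m) ℝ} (hB : B.PosDef) {b : ℝ}
    (hb : 0 ≤ b) (u : Fin m → ℝ) : (B + b • vecMulVec u u).PosDef :=
  hB.add_posSemidef ((posSemidef_vecMulVec u).smul hb)

/-- The one-observation step of the matrix-variate integral. -/
lemma lintegral_det_add_smul_vecMulVec {B : Matrix (Fin m) (Fin m) ℝ} (hB : B.PosDef) {a b : ℝ}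
    (ha : (m : ℝ) / 2 < a) (hb : 0 < b) (w : Fin m → ℝ) :
    ∫⁻ y : Fin m → ℝ, ENNReal.ofReal ((B + b • vecMulVec (y - w) (y - w)).det ^ (-a)) =
      ENNReal.ofReal (B.det ^ (-(a - 1 / 2)) * (b ^ (-((m : ℝ) / 2)) *
        (Real.pi ^ ((m : ℝ) / 2) * Real.Gamma (a - (m : ℝ) / 2) / Real.Gamma a))) := by
  obtain ⟨L, hL, hBL⟩ := exists_eq_mul_transpose hB
  have hs : 0 < (√b)⁻¹ := by positivity
  rw [lintegral_sub_right_eq_self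
    (fun y => ENNReal.ofReal ((B + b • vecMulVec y y).det ^ (-a))) w]
  have hdet : ((√b)⁻¹ • L).det = (√b)⁻¹ ^ m * L.det := by simp
  have hmeas : Measurable fun y : Fin m → ℝ =>
      ENNReal.ofReal ((B + b • vecMulVec y y).det ^ (-a)) := by
    have : Continuous fun y : Fin m → ℝ => (B + b • vecMulVec y y).det := by
      refine Continuous.matrix_det ?_
      exact continuous_const.add ((continuous_id.matrix_vecMulVec continuous_id).const_smul b)
    exact (this.measurable.pow_const _).ennreal_ofReal
  -- Substituting y = b^(-1/2) L v turns B + b yyᵀ into L(1 + vvᵀ)Lᵀ. The Jacobian supplies b^(-m/2)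
  -- and |det L| = (det B)^(1/2), whence the exponent -(a - 1/2).
  rw [lintegral_eq_abs_det_mul_lintegral_mulVec (L := (√b)⁻¹ • L)
    (by rw [hdet]; positivity) hmeas]
  have hB0 := hB.det_pos
  have hpt : ∀ v : Fin m → ℝ,
      (B + b • vecMulVec (((√b)⁻¹ • L) *ᵥ v) (((√b)⁻¹ • L) *ᵥ v)).det ^ (-a) =
        B.det ^ (-a) * (1 + v ⬝ᵥ v) ^ (-a) := fun v => by
    have : B + b • vecMulVec (((√b)⁻¹ • L) *ᵥ v) (((√b)⁻¹ • L) *ᵥ v) =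
        L * (1 + vecMulVec v v) * Lᵀ := by
      have hbb : b * ((√b)⁻¹ * (√b)⁻¹) = 1 := by
        rw [← mul_inv, Real.mul_self_sqrt hb.le, mul_inv_cancel₀ hb.ne']
      rw [hBL, Matrix.mul_add, Matrix.add_mul, Matrix.mul_one, mul_vecMulVec, vecMulVec_mul,
        vecMul_transpose, smul_mulVec, smul_vecMulVec, vecMulVec_smul, smul_smul, smul_smul,
        mul_assoc, hbb, one_smul]
    have hv := zero_le_dotProduct_self v
    rw [this, det_mul, det_mul, mul_right_comm, ← det_mul, ← hBL, det_one_add_vecMulVec_self,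
      Real.mul_rpow hB0.le (by linarith)]
  simp_rw [hpt, ENNReal.ofReal_mul (Real.rpow_nonneg hB0.le (-a))]
  rw [lintegral_const_mul' _ _ ENNReal.ofReal_ne_top, lintegral_one_add_dotProduct_rpow ha,
    ← mul_assoc, ← ENNReal.ofReal_mul (abs_nonneg _),
    ← ENNReal.ofReal_mul (mul_nonneg (abs_nonneg _) (Real.rpow_nonneg hB0.le _)), ← mul_assoc]
  congr 2
  have hLB : |L.det| = B.det ^ (1 / 2 : ℝ) := by
    rw [← Real.sqrt_eq_rpow, hBL, det_mul, det_transpose, Real.sqrt_mul_self_eq_abs]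
  have hbm : (√b)⁻¹ ^ m = b ^ (-((m : ℝ) / 2)) := by
    rw [inv_pow, Real.sqrt_eq_rpow, ← Real.rpow_natCast, ← Real.rpow_mul hb.le,
      ← Real.rpow_neg hb.le]
    ring_nf
  rw [hdet, abs_mul, hLB, abs_of_nonneg (by positivity : (0 : ℝ) ≤ (√b)⁻¹ ^ m), hbm,
    mul_assoc, ← Real.rpow_add hB0, mul_comm]
  ring_nf

end Integrals

/-! ### The shrunken scatter matrix and its determinant integral. -/

section Scatter

/-- The shrunken scatter matrix `∑ᵢ yᵢ yᵢᵀ - (n + c)⁻¹ (∑ᵢ yᵢ) (∑ᵢ yᵢ)ᵀ`. -/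
def scatter (c : ℝ) (y : Fin n → Fin m → ℝ) : Matrix (Fin m) (Fin m) ℝ :=
  ∑ i, vecMulVec (y i) (y i) - ((n : ℝ) + c)⁻¹ • vecMulVec (∑ i, y i) (∑ i, y i)

/-- Welford's recursion for the shrunken scatter matrix. -/
lemma scatter_cons {c : ℝ} (hc : 0 < c) (u : Fin m → ℝ) (y : Fin n → Fin m → ℝ) :
    scatter c (Fin.cons u y : Fin (n + 1) → Fin m → ℝ) = scatter c y +
      (((n : ℝ) + c) / ((n : ℝ) + 1 + c)) •
        vecMulVec (u - ((n : ℝ) + c)⁻¹ • ∑ i, y i) (u - ((n : ℝ) + c)⁻¹ • ∑ i, y i) := by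
  have h1 : (n : ℝ) + c ≠ 0 := by positivity
  have h2 : (n : ℝ) + 1 + c ≠ 0 := by positivity
  unfold scatter
  simp only [Fin.sum_univ_succ, Fin.cons_zero, Fin.cons_succ]
  set s := ∑ i, y i
  ext i j
  simp only [Matrix.sub_apply, Matrix.add_apply, Matrix.smul_apply, vecMulVec_apply, Pi.add_apply, Pi.sub_apply,
    Pi.smul_apply, smul_eq_mul]
  push_cast
  field_simp
  ring

/-- Positivity is hidden by the subtraction in `scatter`, but Welford's recursion only ever adds
nonnegative multiples of rank-one squares. -/
lemma posDef_add_scatter {A : Matrix (Fin m) (Fin m) ℝ} (hA : A.PosDef) {c : ℝ} (hc : 0 < c)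
    (y : Fin n → Fin m → ℝ) : (A + scatter c y).PosDef := by
  induction n with
  | zero => simpa [scatter] using hA
  | succ n ih =>
    rw [← Fin.cons_self_tail y, scatter_cons hc, ← add_assoc]
    exact posDef_add_smul_vecMulVec (ih _) (by positivity) _

lemma continuous_scatter (c : ℝ) :
    Continuous (scatter c : (Fin n → Fin m → ℝ) → Matrix (Fin m) (Fin m) ℝ) := by
  unfold scatter
  have h : ∀ i : Fin n, Continuous fun y : Fin n → Fin m → ℝ => y i := fun i => continuous_apply i
  have hs : Continuous fun y : Fin n → Fin m → ℝ => ∑ i, y i :=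
    continuous_finsetSum _ fun i _ => h i
  exact (continuous_finsetSum _ fun i _ => (h i).matrix_vecMulVec (h i)).sub
    ((hs.matrix_vecMulVec hs).const_smul ((n : ℝ) + c)⁻¹)

lemma continuous_det_add_scatter (A : Matrix (Fin m) (Fin m) ℝ) (c : ℝ) :
    Continuous fun y : Fin n → Fin m → ℝ => (A + scatter c y).det :=
  (continuous_const.add (continuous_scatter c)).matrix_det

lemma multiGamma_pos {z : ℝ} (hz : ((m : ℝ) - 1) / 2 < z) : 0 < multiGamma m z := by
  refine mul_pos (Real.rpow_pos_of_pos Real.pi_pos _) (Finset.prod_pos fun j hj => ?_)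
  have : (j : ℝ) + 1 ≤ m := by exact_mod_cast Finset.mem_range.1 hj
  exact Real.Gamma_pos_of_pos (by linarith)

/-- Both sides are the same power of π times Γ(z)Γ(z - 1/2)⋯Γ(z - m/2), with the first or the last
factor split off. This makes the Gamma quotients telescope. -/
lemma multiGamma_sub_half_mul (z : ℝ) :
    multiGamma m (z - 1 / 2) * Real.Gamma z = multiGamma m z * Real.Gamma (z - (m : ℝ) / 2) := by
  have h := Finset.prod_range_succ (fun j : ℕ => Real.Gamma (z - (j : ℝ) / 2)) m
  rw [Finset.prod_range_succ'] at h
  have h2 : ∀ j : ℕ, z - 1 / 2 - (j : ℝ) / 2 = z - ((j + 1 : ℕ) : ℝ) / 2 := fun j => by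
    push_cast; ring
  unfold multiGamma
  simp_rw [h2]
  simp only [Nat.cast_zero, zero_div, sub_zero] at h
  rw [mul_assoc, h, mul_assoc]

/-- The matrix-variate Student integral with shrunken scatter matrix. -/
lemma lintegral_det_add_scatter {A : Matrix (Fin m) (Fin m) ℝ} (hA : A.PosDef) {c ν : ℝ}
    (hc : 0 < c) (hν : (m : ℝ) - 1 < ν) (hν0 : 0 < ν) :
    ∫⁻ y : Fin n → Fin m → ℝ, ENNReal.ofReal ((A + scatter c y).det ^ (-(((n : ℝ) + ν) / 2))) =
      ENNReal.ofReal (A.det ^ (-(ν / 2)) * ((((n : ℝ) + c) / c) ^ ((m : ℝ) / 2) *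
        Real.pi ^ ((m : ℝ) * n / 2) * (multiGamma m (ν / 2) / multiGamma m (((n : ℝ) + ν) / 2)))) := by
  induction n with
  | zero =>
    have hM : multiGamma m (ν / 2) ≠ 0 := (multiGamma_pos (by linarith)).ne'
    have h0 : ∀ y : Fin 0 → Fin m → ℝ, scatter c y = 0 := fun y => by simp [scatter]
    simp [h0, hM, hc.ne', volume_pi]
  | succ n ih =>
    have hmeas : Measurable fun y : Fin (n + 1) → Fin m → ℝ =>
        ENNReal.ofReal ((A + scatter c y).det ^ (-((((n + 1 : ℕ) : ℝ) + ν) / 2))) :=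
      ((continuous_det_add_scatter A c).measurable.pow_const _).ennreal_ofReal
    have hmp := volume_preserving_piFinSuccAbove (fun _ : Fin (n + 1) => Fin m → ℝ) 0
    have hmeas' := hmeas.comp (MeasurableEquiv.piFinSuccAbove
      (fun _ : Fin (n + 1) => Fin m → ℝ) 0).symm.measurable
    simp only [Function.comp_def] at hmeas'
    -- Convergence of the one-observation integral: at n = 0 this is exactly ν > m - 1.
    have ha : (m : ℝ) / 2 < (((n + 1 : ℕ) : ℝ) + ν) / 2 := by
      push_cast; have : (0 : ℝ) ≤ n := n.cast_nonneg
      linarith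
    have hb : 0 < ((n : ℝ) + c) / ((n : ℝ) + 1 + c) := by positivity
    -- The first observation becomes the inner variable, with the others held fixed as `y`.
    rw [← hmp.symm.lintegral_comp_emb (MeasurableEquiv.measurableEmbedding _), Measure.volume_eq_prod,
      lintegral_prod_symm _ hmeas'.aemeasurable]
    have hinner : ∀ y : Fin n → Fin m → ℝ, ∫⁻ u : Fin m → ℝ, ENNReal.ofReal
        ((A + scatter c ((MeasurableEquiv.piFinSuccAbove
          (fun _ : Fin (n + 1) => Fin m → ℝ) 0).symm (u, y))).det ^
          (-((((n + 1 : ℕ) : ℝ) + ν) / 2))) =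
        ENNReal.ofReal ((A + scatter c y).det ^ (-(((n : ℝ) + ν) / 2))) *
          ENNReal.ofReal ((((n : ℝ) + c) / ((n : ℝ) + 1 + c)) ^ (-((m : ℝ) / 2)) *
            (Real.pi ^ ((m : ℝ) / 2) * Real.Gamma ((((n + 1 : ℕ) : ℝ) + ν) / 2 - (m : ℝ) / 2) /
              Real.Gamma ((((n + 1 : ℕ) : ℝ) + ν) / 2))) := fun y => by
      have hcons : ∀ u : Fin m → ℝ, (MeasurableEquiv.piFinSuccAbove
          (fun _ : Fin (n + 1) => Fin m → ℝ) 0).symm (u, y) = Fin.cons u y := fun u => by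
        simp [MeasurableEquiv.piFinSuccAbove]
        rfl
      have hD := posDef_add_scatter hA hc y
      simp_rw [hcons, scatter_cons hc, ← add_assoc]
      rw [lintegral_det_add_smul_vecMulVec hD ha hb,
        ENNReal.ofReal_mul (Real.rpow_nonneg hD.det_pos.le _)]
      congr 4
      push_cast
      ring
    simp_rw [hinner]
    rw [lintegral_mul_const' _ _ ENNReal.ofReal_ne_top, ih]
    have hM : 0 < multiGamma m (ν / 2) := multiGamma_pos (by linarith)
    have hMn : 0 < multiGamma m (((n : ℝ) + ν) / 2) := multiGamma_pos (by
      have : (0 : ℝ) ≤ n := n.cast_nonneg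
      linarith)
    have hMs : 0 < multiGamma m ((((n + 1 : ℕ) : ℝ) + ν) / 2) := multiGamma_pos (by linarith)
    have hG : 0 < Real.Gamma ((((n + 1 : ℕ) : ℝ) + ν) / 2) :=
      Real.Gamma_pos_of_pos (by positivity)
    have hrec := multiGamma_sub_half_mul (m := m) ((((n + 1 : ℕ) : ℝ) + ν) / 2)
    rw [show (((n + 1 : ℕ) : ℝ) + ν) / 2 - 1 / 2 = ((n : ℝ) + ν) / 2 by push_cast; ring] at hrec
    have hA0 := hA.det_pos
    rw [← ENNReal.ofReal_mul (by positivity)]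
    congr 1
    -- The Welford weight advances (n+c)/c to (n+1+c)/c.
    have hpow : (((n : ℝ) + c) / c) ^ ((m : ℝ) / 2) *
        (((n : ℝ) + c) / ((n : ℝ) + 1 + c)) ^ (-((m : ℝ) / 2)) =
        ((((n + 1 : ℕ) : ℝ) + c) / c) ^ ((m : ℝ) / 2) := by
      rw [Real.rpow_neg hb.le, ← Real.inv_rpow hb.le, ← Real.mul_rpow (by positivity) (by positivity)]
      congr 1
      push_cast
      field_simp
    have hpi : Real.pi ^ ((m : ℝ) * ((n + 1 : ℕ) : ℝ) / 2) =
        Real.pi ^ ((m : ℝ) * n / 2) * Real.pi ^ ((m : ℝ) / 2) := by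
      rw [← Real.rpow_add Real.pi_pos]
      congr 1
      push_cast
      ring
    have hgam : multiGamma m (ν / 2) / multiGamma m (((n : ℝ) + ν) / 2) *
        (Real.Gamma ((((n + 1 : ℕ) : ℝ) + ν) / 2 - (m : ℝ) / 2) /
          Real.Gamma ((((n + 1 : ℕ) : ℝ) + ν) / 2)) =
        multiGamma m (ν / 2) / multiGamma m ((((n + 1 : ℕ) : ℝ) + ν) / 2) := by
      generalize Real.Gamma ((((n + 1 : ℕ) : ℝ) + ν) / 2 - (m : ℝ) / 2) = G at hrec ⊢
      field_simp
      linear_combination -hrec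
    rw [← hpow, hpi, ← hgam]
    ring

end Scatter

/-! ### Factorization of the objective and the MAP estimate. -/

section MAP

/-- Completing the square in the location parameter. -/
lemma sum_vecMulVec_sub_add {c : ℝ} (hc : 0 < c) (y : Fin n → Fin m → ℝ) (u : Fin m → ℝ) :
    ∑ i, vecMulVec (y i - u) (y i - u) + c • vecMulVec u u = scatter c y +
      ((n : ℝ) + c) • vecMulVec (u - ((n : ℝ) + c)⁻¹ • ∑ i, y i)
        (u - ((n : ℝ) + c)⁻¹ • ∑ i, y i) := by
  have h1 : (n : ℝ) + c ≠ 0 := by positivity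
  unfold scatter
  ext i j
  simp only [Matrix.sub_apply, Matrix.add_apply, Matrix.smul_apply, vecMulVec_apply, Pi.sub_apply,
    Pi.smul_apply, smul_eq_mul, Matrix.sum_apply, Finset.sum_apply, sub_mul, mul_sub,
    Finset.sum_sub_distrib, Finset.sum_const, Finset.card_univ, Fintype.card_fin, nsmul_eq_mul,
    ← Finset.sum_mul, ← Finset.mul_sum]
  field_simp
  ring

/-- The double sum of outer products is the outer product of the sum with itself, so the estimate is
a rescaled shrunken scatter with c = ρ²ν. -/
lemma mapCov_eq {ν ρsq : ℝ} (hν : 0 < ν) (hρ : 0 < ρsq) (μ₀ : Fin m → ℝ)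
    (S₀ : Matrix (Fin m) (Fin m) ℝ) (x : Fin n → Fin m → ℝ) :
    mapCov ν μ₀ S₀ ρsq x =
      ((n : ℝ) + ν)⁻¹ • (ν • S₀ + scatter (ρsq * ν) fun i => x i - μ₀) := by
  have h1 : (n : ℝ) + ρsq * ν ≠ 0 := by positivity
  have h2 : (n : ℝ) + ν ≠ 0 := by positivity
  unfold mapCov scatter
  ext i j
  simp only [Matrix.sub_apply, Matrix.add_apply, Matrix.smul_apply, vecMulVec_apply, Pi.sub_apply,
    smul_eq_mul, Matrix.sum_apply, Finset.sum_apply, ← Finset.sum_mul, ← Finset.mul_sum]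
  rw [show (ν + n) * (ρsq * ν + n) = ((n : ℝ) + ν) * (n + ρsq * ν) by ring]
  field_simp
  ring

lemma posDef_mapCov {ν ρsq : ℝ} (hν : 0 < ν) (hρ : 0 < ρsq) (μ₀ : Fin m → ℝ)
    {S₀ : Matrix (Fin m) (Fin m) ℝ} (hS₀ : S₀.PosDef) (x : Fin n → Fin m → ℝ) :
    (mapCov ν μ₀ S₀ ρsq x).PosDef := by
  rw [mapCov_eq hν hρ]
  exact (posDef_add_scatter (hS₀.smul hν) (mul_pos hρ hν) _).smul (by positivity)

/-- The penalized likelihood in terms of the estimates. -/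
lemma normalDensity_mul_luckiness {ν ρsq : ℝ} (hν : 0 < ν) (hρ : 0 < ρsq) (μ₀ : Fin m → ℝ)
    (S₀ : Matrix (Fin m) (Fin m) ℝ) (x : Fin n → Fin m → ℝ) (μ : Fin m → ℝ)
    {S : Matrix (Fin m) (Fin m) ℝ} (hS : S.PosDef) :
    normalDensity x μ S * luckiness ν μ₀ S₀ ρsq μ S =
      (2 * Real.pi) ^ (-((m : ℝ) * ((n : ℝ) + ν) / 2)) *
        (S.det ^ (-(((n : ℝ) + ν) / 2)) *
          Real.exp (-(((n : ℝ) + ν) / 2) * (S⁻¹ * mapCov ν μ₀ S₀ ρsq x).trace)) *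
        Real.exp (-(((n : ℝ) + ρsq * ν) / 2) *
          ((μ - mapMean ν μ₀ ρsq x) ⬝ᵥ (S⁻¹ *ᵥ (μ - mapMean ν μ₀ ρsq x)))) := by
  have hdet := hS.det_pos
  have hpi : 0 < 2 * Real.pi := by positivity
  have hc : 0 < ρsq * ν := mul_pos hρ hν
  have hN : (n : ℝ) + ν ≠ 0 := by positivity
  -- Centring at μ₀ makes the luckiness term c(μ - μ₀)(μ - μ₀)ᵀ the completing term of the square.
  have hsq := sum_vecMulVec_sub_add hc (fun i => x i - μ₀) (μ - μ₀)
  simp only [sub_sub_sub_cancel_right] at hsq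
  rw [show μ - μ₀ - ((n : ℝ) + ρsq * ν)⁻¹ • ∑ i, (x i - μ₀) = μ - mapMean ν μ₀ ρsq x by
    rw [mapMean, one_div]; abel] at hsq
  have hcov : ((n : ℝ) + ν) • mapCov ν μ₀ S₀ ρsq x =
      ν • S₀ + scatter (ρsq * ν) fun i => x i - μ₀ := by
    rw [mapCov_eq hν hρ, smul_smul, mul_inv_cancel₀ hN, one_smul]
  have htr : (∑ i, (x i - μ) ⬝ᵥ (S⁻¹ *ᵥ (x i - μ))) +
      ν * (S⁻¹ * (S₀ + ρsq • vecMulVec (μ - μ₀) (μ - μ₀))).trace =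
      ((n : ℝ) + ν) * (S⁻¹ * mapCov ν μ₀ S₀ ρsq x).trace + ((n : ℝ) + ρsq * ν) *
        ((μ - mapMean ν μ₀ ρsq x) ⬝ᵥ (S⁻¹ *ᵥ (μ - mapMean ν μ₀ ρsq x))) := by
    simp only [dotProduct_mulVec_eq_trace]
    have h1 := congrArg (fun M => (S⁻¹ * M).trace) hsq
    have h2 := congrArg (fun M => (S⁻¹ * M).trace) hcov
    simp only [Matrix.mul_add, Matrix.mul_smul, Matrix.mul_sum, trace_add, trace_smul, trace_sum,
      smul_eq_mul] at h1 h2 ⊢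
    linear_combination h1 - h2
  unfold normalDensity luckiness
  have hinv : ∀ p q : ℝ, 1 / ((2 * Real.pi) ^ p * S.det ^ q) =
      (2 * Real.pi) ^ (-p) * S.det ^ (-q) := fun p q => by
    rw [Real.rpow_neg hpi.le, Real.rpow_neg hdet.le, one_div, mul_inv]
  rw [hinv, hinv,
    show -((m : ℝ) * ((n : ℝ) + ν) / 2) = -((m : ℝ) * n / 2) + -((m : ℝ) * ν / 2) by ring,
    show S.det ^ (-(((n : ℝ) + ν) / 2)) = S.det ^ (-((n : ℝ) / 2)) * S.det ^ (-(ν / 2)) by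
      rw [← Real.rpow_add hdet]; ring_nf, Real.rpow_add hpi]
  have hexp : Real.exp (-(1 / 2) * ∑ i, (x i - μ) ⬝ᵥ (S⁻¹ *ᵥ (x i - μ))) *
      Real.exp (-(ν / 2) * (S⁻¹ * (S₀ + ρsq • vecMulVec (μ - μ₀) (μ - μ₀))).trace) =
      Real.exp (-(((n : ℝ) + ν) / 2) * (S⁻¹ * mapCov ν μ₀ S₀ ρsq x).trace) *
        Real.exp (-(((n : ℝ) + ρsq * ν) / 2) *
          ((μ - mapMean ν μ₀ ρsq x) ⬝ᵥ (S⁻¹ *ᵥ (μ - mapMean ν μ₀ ρsq x)))) := by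
    rw [← Real.exp_add, ← Real.exp_add]
    congr 1
    linear_combination (-1 / 2 : ℝ) * htr
  linear_combination ((2 * Real.pi) ^ (-((m : ℝ) * n / 2)) * (2 * Real.pi) ^ (-((m : ℝ) * ν / 2)) *
    S.det ^ (-((n : ℝ) / 2)) * S.det ^ (-(ν / 2))) * hexp

lemma normalDensity_mul_luckiness_map {ν ρsq : ℝ} (hν : 0 < ν) (hρ : 0 < ρsq) (μ₀ : Fin m → ℝ)
    {S₀ : Matrix (Fin m) (Fin m) ℝ} (hS₀ : S₀.PosDef) (x : Fin n → Fin m → ℝ) :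
    normalDensity x (mapMean ν μ₀ ρsq x) (mapCov ν μ₀ S₀ ρsq x) *
        luckiness ν μ₀ S₀ ρsq (mapMean ν μ₀ ρsq x) (mapCov ν μ₀ S₀ ρsq x) =
      (2 * Real.pi) ^ (-((m : ℝ) * ((n : ℝ) + ν) / 2)) *
        ((mapCov ν μ₀ S₀ ρsq x).det ^ (-(((n : ℝ) + ν) / 2)) *
          Real.exp (-(((n : ℝ) + ν) / 2) * m)) := by
  have hT := posDef_mapCov hν hρ μ₀ hS₀ x
  rw [normalDensity_mul_luckiness hν hρ μ₀ S₀ x _ hT, nonsing_inv_mul _ hT.det_pos.ne'.isUnit]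
  simp

/-- The factorization separates the parameters: the Gaussian factor is 1 only at the MAP mean, and
the remaining factor peaks only at the MAP covariance, which does not depend on μ. -/
lemma isMAP_iff {ν ρsq : ℝ} (hν : 0 < ν) (hρ : 0 < ρsq) (μ₀ : Fin m → ℝ)
    {S₀ : Matrix (Fin m) (Fin m) ℝ} (hS₀ : S₀.PosDef) (x : Fin n → Fin m → ℝ) (μ : Fin m → ℝ)
    (S : Matrix (Fin m) (Fin m) ℝ) :
    IsMAP ν μ₀ S₀ ρsq x μ S ↔ μ = mapMean ν μ₀ ρsq x ∧ S = mapCov ν μ₀ S₀ ρsq x := by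
  have hT := posDef_mapCov hν hρ μ₀ hS₀ x
  have hN : 0 < ((n : ℝ) + ν) / 2 := by positivity
  have hk : 0 < ((n : ℝ) + ρsq * ν) / 2 := by positivity
  have hK : 0 < (2 * Real.pi) ^ (-((m : ℝ) * ((n : ℝ) + ν) / 2)) := by positivity
  constructor
  · rintro ⟨hS, hmax⟩
    have h := hmax (mapMean ν μ₀ ρsq x) _ hT
    rw [normalDensity_mul_luckiness_map hν hρ μ₀ hS₀, normalDensity_mul_luckiness hν hρ μ₀ S₀ x _ hS,
      mul_assoc] at h
    obtain ⟨hle, heq⟩ := det_rpow_mul_exp_trace_le hS hT hN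
    have h := le_of_mul_le_mul_left h hK
    set d := μ - mapMean ν μ₀ ρsq x with hd
    have hP : 0 < S.det ^ (-(((n : ℝ) + ν) / 2)) *
        Real.exp (-(((n : ℝ) + ν) / 2) * (S⁻¹ * mapCov ν μ₀ S₀ ρsq x).trace) :=
      mul_pos (Real.rpow_pos_of_pos hS.det_pos _) (Real.exp_pos _)
    -- If d ≠ 0, the last factor is below 1, so the value falls strictly below the bound `hle`,
    -- against maximality `h`.
    have hd0 : d = 0 := by
      by_contra hne
      have hq : 0 < d ⬝ᵥ (S⁻¹ *ᵥ d) := by simpa using hS.inv.dotProduct_mulVec_pos hne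
      have he : Real.exp (-(((n : ℝ) + ρsq * ν) / 2) * (d ⬝ᵥ (S⁻¹ *ᵥ d))) < 1 :=
        Real.exp_lt_one_iff.2 (by nlinarith)
      nlinarith
    refine ⟨sub_eq_zero.1 hd0, heq (le_antisymm hle ?_)⟩
    simpa [hd0] using h
  · rintro ⟨rfl, rfl⟩
    refine ⟨hT, fun μ' S' hS' => ?_⟩
    rw [normalDensity_mul_luckiness_map hν hρ μ₀ hS₀, normalDensity_mul_luckiness hν hρ μ₀ S₀ x _ hS',
      mul_assoc]
    refine mul_le_mul_of_nonneg_left ?_ hK.le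
    have hle := (det_rpow_mul_exp_trace_le hS' hT hN).1
    have hP : 0 ≤ S'.det ^ (-(((n : ℝ) + ν) / 2)) *
        Real.exp (-(((n : ℝ) + ν) / 2) * (S'⁻¹ * mapCov ν μ₀ S₀ ρsq x).trace) :=
      mul_nonneg (Real.rpow_nonneg hS'.det_pos.le _) (Real.exp_pos _).le
    have hq : 0 ≤ (μ' - mapMean ν μ₀ ρsq x) ⬝ᵥ (S'⁻¹ *ᵥ (μ' - mapMean ν μ₀ ρsq x)) := by
      simpa using hS'.inv.posSemidef.dotProduct_mulVec_nonneg (μ' - mapMean ν μ₀ ρsq x)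
    refine le_trans (mul_le_of_le_one_right hP (Real.exp_le_one_iff.2 ?_)) hle
    nlinarith

/-- The MAP point lies in the model and attains the bound, so the `sSup` is a true maximum and not a
default value. -/
lemma maxValue_normalModel {ν ρsq : ℝ} (hν : 0 < ν) (hρ : 0 < ρsq) (μ₀ : Fin m → ℝ)
    {S₀ : Matrix (Fin m) (Fin m) ℝ} (hS₀ : S₀.PosDef) (x : Fin n → Fin m → ℝ) :
    maxValue (normalModel n ν μ₀ S₀ ρsq) x =
      normalDensity x (mapMean ν μ₀ ρsq x) (mapCov ν μ₀ S₀ ρsq x) *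
        luckiness ν μ₀ S₀ ρsq (mapMean ν μ₀ ρsq x) (mapCov ν μ₀ S₀ ρsq x) := by
  obtain ⟨hT, hmax⟩ := (isMAP_iff hν hρ μ₀ hS₀ x _ _).2 ⟨rfl, rfl⟩
  refine IsGreatest.csSup_eq ⟨⟨_, ⟨_, _, hT, rfl⟩, rfl⟩, ?_⟩
  rintro v ⟨p, ⟨μ, S, hS, rfl⟩, rfl⟩
  exact hmax μ S hS

end MAP

/-! ### Evaluation of the capacity. -/

section Capacity

lemma capacityConst_pos {ν ρsq D : ℝ} (hν : (m : ℝ) - 1 < ν) (hν0 : 0 < ν) (hρ : 0 < ρsq)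
    (hD : 0 < D) : 0 < capacityConst m n ν D ρsq := by
  have h1 : 0 < multiGamma m (ν / 2) := multiGamma_pos (by linarith)
  have h2 : 0 < multiGamma m (((n : ℝ) + ν) / 2) := multiGamma_pos (by
    have : (0 : ℝ) ≤ n := n.cast_nonneg
    linarith)
  unfold capacityConst
  positivity

/-- The maximized penalized likelihood, with the determinant of the scatter matrix isolated. -/
lemma maxValue_normalModel_eq_scatter {ν ρsq : ℝ} (hν : 0 < ν) (hρ : 0 < ρsq) (μ₀ : Fin m → ℝ)
    {S₀ : Matrix (Fin m) (Fin m) ℝ} (hS₀ : S₀.PosDef) (x : Fin n → Fin m → ℝ) :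
    maxValue (normalModel n ν μ₀ S₀ ρsq) x =
      (2 * Real.pi) ^ (-((m : ℝ) * ((n : ℝ) + ν) / 2)) * Real.exp (-(((n : ℝ) + ν) / 2) * m) *
        ((n : ℝ) + ν) ^ ((m : ℝ) * ((n : ℝ) + ν) / 2) *
        (ν • S₀ + scatter (ρsq * ν) fun i => x i - μ₀).det ^ (-(((n : ℝ) + ν) / 2)) := by
  have hN : 0 < (n : ℝ) + ν := by positivity
  have hD := (posDef_add_scatter (hS₀.smul hν) (mul_pos hρ hν) fun i => x i - μ₀).det_pos
  rw [maxValue_normalModel hν hρ μ₀ hS₀, normalDensity_mul_luckiness_map hν hρ μ₀ hS₀,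
    mapCov_eq hν hρ, det_smul, Fintype.card_fin, Real.mul_rpow (by positivity) hD.le,
    ← Real.rpow_natCast, ← Real.rpow_mul (by positivity), Real.inv_rpow hN.le, ← Real.rpow_neg hN.le]
  generalize (ν • S₀ + scatter (ρsq * ν) fun i => x i - μ₀).det = D
  ring_nf

lemma lintegral_maxValue_normalModel (hm : 1 ≤ m) {ν ρsq : ℝ} (hν : (m : ℝ) - 1 < ν) (hν0 : 0 < ν)
    (hρ : 0 < ρsq) (μ₀ : Fin m → ℝ) {S₀ : Matrix (Fin m) (Fin m) ℝ} (hS₀ : S₀.PosDef) :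
    ∫⁻ x, ENNReal.ofReal (maxValue (normalModel n ν μ₀ S₀ ρsq) x) =
      ENNReal.ofReal (capacityConst m n ν (S₀.det ^ (1 / (m : ℝ))) ρsq) := by
  have hN : 0 < (n : ℝ) + ν := by positivity
  have hm0 : (0 : ℝ) < m := by exact_mod_cast hm
  have hD := hS₀.det_pos
  have hA : (ν • S₀).PosDef := hS₀.smul hν0
  have h1 : 0 < multiGamma m (ν / 2) := multiGamma_pos (by linarith)
  have h2 : 0 < multiGamma m (((n : ℝ) + ν) / 2) := multiGamma_pos (by
    have : (0 : ℝ) ≤ n := n.cast_nonneg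
    linarith)
  simp_rw [maxValue_normalModel_eq_scatter hν0 hρ μ₀ hS₀]
  set K := (2 * Real.pi) ^ (-((m : ℝ) * ((n : ℝ) + ν) / 2)) *
    Real.exp (-(((n : ℝ) + ν) / 2) * m) * ((n : ℝ) + ν) ^ ((m : ℝ) * ((n : ℝ) + ν) / 2) with hKdef
  have hK : 0 < K := by positivity
  simp_rw [ENNReal.ofReal_mul hK.le]
  rw [lintegral_const_mul' _ _ ENNReal.ofReal_ne_top]
  -- Translation invariance removes μ₀ from every observation at once.
  have htrans := lintegral_sub_right_eq_self (μ := (volume : Measure (Fin n → Fin m → ℝ)))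
    (fun y => ENNReal.ofReal ((ν • S₀ + scatter (ρsq * ν) y).det ^ (-(((n : ℝ) + ν) / 2))))
    (fun _ => μ₀)
  rw [show (∫⁻ x : Fin n → Fin m → ℝ, ENNReal.ofReal
      ((ν • S₀ + scatter (ρsq * ν) fun i => x i - μ₀).det ^ (-(((n : ℝ) + ν) / 2)))) = _ from htrans,
    lintegral_det_add_scatter hA (mul_pos hρ hν0) hν hν0, ← ENNReal.ofReal_mul hK.le]
  congr 1
  unfold capacityConst
  rw [← mul_assoc, ← mul_assoc]
  congr 1
  rw [hKdef, det_smul, Fintype.card_fin]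
  have hW : 1 + (n : ℝ) / (ρsq * ν) = ((n : ℝ) + ρsq * ν) / (ρsq * ν) := by field_simp; ring
  rw [hW]
  set W := ((n : ℝ) + ρsq * ν) / (ρsq * ν)
  have hWpos : 0 < W := by positivity
  -- With the `multiGamma` quotient cancelled, both sides are positive products of powers, so
  -- logarithms reduce the claim to linear algebra in the logs. The exponent 1/m on det S₀ requires
  -- m ≠ 0 here.
  refine Real.log_injOn_pos (Set.mem_Ioi.2 (by positivity)) (Set.mem_Ioi.2 (by positivity)) ?_
  simp (disch := positivity) only [Real.log_mul, Real.log_div, Real.log_rpow, Real.log_exp,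
    Real.log_sqrt, Real.log_pow, Real.log_one]
  field_simp
  ring

/-- The `ENNReal` value is finite, which gives integrability of the nonnegative maximum; only then
does the Bochner integral defining `capacity` carry meaning. -/
lemma integrable_maxValue_and_capacity_eq (hm : 1 ≤ m) {ν ρsq : ℝ} (hν : (m : ℝ) - 1 < ν)
    (hν0 : 0 < ν) (hρ : 0 < ρsq) (μ₀ : Fin m → ℝ) {S₀ : Matrix (Fin m) (Fin m) ℝ}
    (hS₀ : S₀.PosDef) :
    Integrable (maxValue (normalModel n ν μ₀ S₀ ρsq)) ∧
      capacity volume (normalModel n ν μ₀ S₀ ρsq) =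
        capacityConst m n ν (S₀.det ^ (1 / (m : ℝ))) ρsq := by
  have hlint := lintegral_maxValue_normalModel (n := n) hm hν hν0 hρ μ₀ hS₀
  have hC := capacityConst_pos (n := n) hν hν0 hρ
    (Real.rpow_pos_of_pos hS₀.det_pos (1 / (m : ℝ)))
  have hnn : ∀ x, 0 ≤ maxValue (normalModel n ν μ₀ S₀ ρsq) x := fun x => by
    rw [maxValue_normalModel hν0 hρ μ₀ hS₀, normalDensity_mul_luckiness_map hν0 hρ μ₀ hS₀]
    have := (posDef_mapCov hν0 hρ μ₀ hS₀ x).det_pos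
    positivity
  have hmeas : Measurable (maxValue (normalModel n ν μ₀ S₀ ρsq)) := by
    rw [funext (maxValue_normalModel_eq_scatter hν0 hρ μ₀ hS₀)]
    have hc : Continuous fun x : Fin n → Fin m → ℝ => fun i => x i - μ₀ :=
      continuous_pi fun i => (continuous_apply i).sub continuous_const
    exact ((((continuous_det_add_scatter (ν • S₀) (ρsq * ν)).comp hc).measurable.pow_const
      _).const_mul _)
  refine ⟨⟨hmeas.aestronglyMeasurable, ?_⟩, ?_⟩
  · rw [hasFiniteIntegral_iff_ofReal (Filter.Eventually.of_forall hnn), hlint]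
    exact ENNReal.ofReal_lt_top
  · rw [capacity, integral_eq_lintegral_of_nonneg_ae (Filter.Eventually.of_forall hnn)
      hmeas.aestronglyMeasurable, hlint, ENNReal.toReal_ofReal hC.le]

end Capacity

end LNML

end

/-! ### The theorem, with the closed form of the LNML. -/

theorem theorem2 (m n : ℕ) (hm : 1 ≤ m) (ν ρsq : ℝ) (hν : (m : ℝ) - 1 < ν) (hρ : 0 < ρsq)
    (μ₀ : Fin m → ℝ) (S₀ : Matrix (Fin m) (Fin m) ℝ) (hS₀ : S₀.PosDef) :
    -- the MAP estimates exist, are unique, and are given by the closed forms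
    (∀ (x : Fin n → Fin m → ℝ) (μ : Fin m → ℝ) (S : Matrix (Fin m) (Fin m) ℝ),
      LNML.IsMAP ν μ₀ S₀ ρsq x μ S ↔
        μ = LNML.mapMean ν μ₀ ρsq x ∧ S = LNML.mapCov ν μ₀ S₀ ρsq x) ∧
    -- the capacity integral converges and has the closed form
    MeasureTheory.Integrable (LNML.maxValue (LNML.normalModel n ν μ₀ S₀ ρsq))
      (MeasureTheory.volume : MeasureTheory.Measure (Fin n → Fin m → ℝ)) ∧
    LNML.capacity MeasureTheory.volume (LNML.normalModel n ν μ₀ S₀ ρsq) =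
      LNML.capacityConst m n ν (S₀.det ^ (1 / (m : ℝ))) ρsq ∧
    -- the two expressions for the LNML
    ∀ x : Fin n → Fin m → ℝ,
      LNML.lnml MeasureTheory.volume (LNML.normalModel n ν μ₀ S₀ ρsq) x =
        LNML.normalDensity x (LNML.mapMean ν μ₀ ρsq x) (LNML.mapCov ν μ₀ S₀ ρsq x) *
          LNML.luckiness ν μ₀ S₀ ρsq (LNML.mapMean ν μ₀ ρsq x) (LNML.mapCov ν μ₀ S₀ ρsq x) /
          LNML.capacityConst m n ν (S₀.det ^ (1 / (m : ℝ))) ρsq ∧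
      LNML.lnml MeasureTheory.volume (LNML.normalModel n ν μ₀ S₀ ρsq) x =
        (ν ^ ν / (Real.pi ^ (n : ℝ) * ((n : ℝ) + ν) ^ ((n : ℝ) + ν) *
          (1 + (n : ℝ) / (ρsq * ν)))) ^ ((m : ℝ) / 2) *
        (LNML.multiGamma m (((n : ℝ) + ν) / 2) / LNML.multiGamma m (ν / 2)) *
        (S₀.det ^ (ν / 2) / (LNML.mapCov ν μ₀ S₀ ρsq x).det ^ (((n : ℝ) + ν) / 2)) := by
  have hm0 : (1 : ℝ) ≤ m := by exact_mod_cast hm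
  have hν0 : 0 < ν := by linarith
  obtain ⟨hint, hcap⟩ := LNML.integrable_maxValue_and_capacity_eq (n := n) hm hν hν0 hρ μ₀ hS₀
  refine ⟨LNML.isMAP_iff hν0 hρ μ₀ hS₀, hint, hcap, fun x => ?_⟩
  have hl : LNML.lnml MeasureTheory.volume (LNML.normalModel n ν μ₀ S₀ ρsq) x =
      LNML.normalDensity x (LNML.mapMean ν μ₀ ρsq x) (LNML.mapCov ν μ₀ S₀ ρsq x) *
        LNML.luckiness ν μ₀ S₀ ρsq (LNML.mapMean ν μ₀ ρsq x) (LNML.mapCov ν μ₀ S₀ ρsq x) /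
        LNML.capacityConst m n ν (S₀.det ^ (1 / (m : ℝ))) ρsq := by
    rw [LNML.lnml, LNML.maxValue_normalModel hν0 hρ μ₀ hS₀, hcap]
  refine ⟨hl, ?_⟩
  rw [hl, LNML.normalDensity_mul_luckiness_map hν0 hρ μ₀ hS₀, LNML.capacityConst]
  have hT := (LNML.posDef_mapCov hν0 hρ μ₀ hS₀ x).det_pos
  have hD := hS₀.det_pos
  have h1 : 0 < LNML.multiGamma m (ν / 2) := LNML.multiGamma_pos (by linarith)
  have h2 : 0 < LNML.multiGamma m (((n : ℝ) + ν) / 2) := LNML.multiGamma_pos (by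
    have : (0 : ℝ) ≤ n := n.cast_nonneg
    linarith)
  have hN : 0 < (n : ℝ) + ν := by positivity
  have hW : 0 < 1 + (n : ℝ) / (ρsq * ν) := by positivity
  generalize 1 + (n : ℝ) / (ρsq * ν) = W at hW ⊢
  -- Powers of 2 and e cancel between the maximum and the capacity; the comparison is again made on
  -- logarithms of positive quantities.
  refine Real.log_injOn_pos (Set.mem_Ioi.2 (by positivity)) (Set.mem_Ioi.2 (by positivity)) ?_
  simp (disch := positivity) only [Real.log_mul, Real.log_div, Real.log_rpow, Real.log_exp,
    Real.log_sqrt, Real.log_one]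
  field_simp
  ring
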